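/- By an affine algebraic set we mean the set $X\subseteq\mathbb C^n$ of common zeros of a set of polynomials (irreducible or not), with coordinate ring $\mathbb C[X]$ the algebra of functions on $X$ that are restrictions of polynomials; morphisms are the maps given by polynomials. An (affine) algebraic group over $\mathbb C$ is an affine algebraic set $G$ with a group structure whose multiplication $G\times G\to G$ and inversion $G\to G$ are morphisms. An affine $G$-variety is an affine algebraic set $Z$ with an action of $G$ such that $G\times Z\to Z$ is a morphism. A finite-dimensional $G$-module is a finite-dimensional complex vector space with a linear $G$-action whose matrix coefficients lie in $\mathbb C[G]$. We say that $G$ satisfies the Nagata hypothesis if for every finite-dimensional $G$-module $M$ and every $G$-invariant hyperplane (codimension-one linear subspace) $N\subseteq M$ such that $G$ acts trivially on $M/N$, there is a decomposition $M=H\oplus P$ into $G$-submodules, where $H$ is a hyperplane and $G$ acts trivially on $P$. Theorem. Let $G$ be an algebraic group over $\mathbb C$ that satisfies the Nagata hypothesis, and let $Z$ be an affine $G$-variety with coordinate ring $\mathbb C[Z]$. Then the ring of invariants $\mathbb C[Z]^G=\{f\in\mathbb C[Z] : f(g\cdot z)=f(z)\text{ for all } g\in G,\ z\in Z\}$ is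 a finitely generated $\mathbb C$-algebra. -/

import Mathlib

/-- `X ⊆ ℂⁿ` is an affine algebraic set: the set of common zeros of a set of polynomials.
Irreducibility is not required, so that disconnected (e.g. finite) groups are included. -/
def IsAffineAlgebraicSet {n : ℕ} (X : Set (Fin n → ℂ)) : Prop :=
  ∃ S : Set (MvPolynomial (Fin n) ℂ), X = {x | ∀ p ∈ S, MvPolynomial.eval x p = 0}

/-- Restriction of polynomials on `ℂⁿ` to functions on `X ⊆ ℂⁿ`. -/
noncomputable def restrictPoly {n : ℕ} (X : Set (Fin n → ℂ)) : MvPolynomial (Fin n) ℂ →ₐ[ℂ] (X → ℂ) :=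
  AlgHom.pi fun x : X => MvPolynomial.aeval (x : Fin n → ℂ)

/-- The coordinate ring `ℂ[X]`: the algebra of functions `X → ℂ` that are restrictions of
polynomials, i.e. `ℂ[x₁, …, xₙ] / I(X)`. -/
noncomputable def coordRing {n : ℕ} (X : Set (Fin n → ℂ)) : Subalgebra ℂ (X → ℂ) :=
  (restrictPoly X).range

/-- A map `X → Y` between subsets of affine spaces is a morphism if its coordinates are given by
polynomials. -/
def IsPolyMap {n m : ℕ} {X : Set (Fin n → ℂ)} {Y : Set (Fin m → ℂ)} (φ : X → Y) : Prop :=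
  ∃ P : Fin m → MvPolynomial (Fin n) ℂ,
    ∀ (x : X) (i : Fin m), (φ x : Fin m → ℂ) i = MvPolynomial.eval (x : Fin n → ℂ) (P i)

/-- A map `X × Y → W`, where `X × Y ⊆ ℂⁿ × ℂᵐ`, is a morphism if its coordinates are given by
polynomials in the `n + m` coordinates. -/
def IsPolyMap₂ {n m k : ℕ} {X : Set (Fin n → ℂ)} {Y : Set (Fin m → ℂ)} {W : Set (Fin k → ℂ)}
    (φ : X → Y → W) : Prop :=
  ∃ P : Fin k → MvPolynomial (Fin n ⊕ Fin m) ℂ,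
    ∀ (x : X) (y : Y) (i : Fin k), (φ x y : Fin k → ℂ) i =
      MvPolynomial.eval (Sum.elim (x : Fin n → ℂ) (y : Fin m → ℂ)) (P i)

/-- `G`, with its group structure, is an (affine) algebraic group over `ℂ`: it is an affine
algebraic set, and multiplication and inversion are morphisms. -/
structure IsAlgebraicGroup {n : ℕ} (G : Set (Fin n → ℂ)) [Group G] : Prop where
  isAffine : IsAffineAlgebraicSet G
  mul_isPolyMap : IsPolyMap₂ (fun g h : G => g * h)
  inv_isPolyMap : IsPolyMap (fun g : G => g⁻¹)

/-- `Z`, with its action of `G`, is an affine `G`-variety: `Z` is an affine algebraic set and the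
action map `G × Z → Z` is a morphism. -/
structure IsAffineGVariety {n m : ℕ} (G : Set (Fin n → ℂ)) [Group G] (Z : Set (Fin m → ℂ))
    [MulAction G Z] : Prop where
  isAffine : IsAffineAlgebraicSet Z
  smul_isPolyMap : IsPolyMap₂ (fun (g : G) (z : Z) => g • z)

/-- A representation of an algebraic group `G` is algebraic (rational) if its matrix coefficients
are regular functions on `G`. -/
def IsAlgebraicRep {n : ℕ} {G : Set (Fin n → ℂ)} [Group G] {M : Type} [AddCommGroup M]
    [Module ℂ M] (ρ : Representation ℂ G M) : Prop :=
  ∀ (v : M) (l : Module.Dual ℂ M), (fun g : G => l (ρ g v)) ∈ coordRing G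

/-- The Nagata hypothesis: for every finite-dimensional algebraic `G`-module `M` and every
`G`-invariant hyperplane `N ⊆ M` such that `G` acts trivially on the line `M / N`, there is a
decomposition `M = H ⊕ P` into `G`-submodules with `H` a hyperplane and `P` (a line) on which `G`
acts trivially. -/
def NagataHypothesis {n : ℕ} (G : Set (Fin n → ℂ)) [Group G] : Prop :=
  ∀ (M : Type) [AddCommGroup M] [Module ℂ M] [FiniteDimensional ℂ M] (ρ : Representation ℂ G M),
    IsAlgebraicRep ρ →
    ∀ N : Submodule ℂ M, Module.finrank ℂ (M ⧸ N) = 1 →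
      (∀ g : G, ∀ v ∈ N, ρ g v ∈ N) →
      (∀ (g : G) (v : M), ρ g v - v ∈ N) →
      ∃ H P : Submodule ℂ M, IsCompl H P ∧ Module.finrank ℂ (M ⧸ H) = 1 ∧
        (∀ g : G, ∀ v ∈ H, ρ g v ∈ H) ∧ (∀ g : G, ∀ v ∈ P, ρ g v = v)

/-- The ring of invariants `ℂ[Z]^G`: the regular functions `f` on `Z` with `f (g • z) = f z`. -/
noncomputable def invariantRing {n m : ℕ} (G : Set (Fin n → ℂ)) [Group G] (Z : Set (Fin m → ℂ))
    [MulAction G Z] : Subalgebra ℂ (coordRing Z) where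
  carrier := {f | ∀ (g : G) (z : Z), (f : Z → ℂ) (g • z) = (f : Z → ℂ) z}
  mul_mem' {a b} ha hb g z := by
    change (a : Z → ℂ) (g • z) * (b : Z → ℂ) (g • z) = (a : Z → ℂ) z * (b : Z → ℂ) z
    rw [ha g z, hb g z]
  add_mem' {a b} ha hb g z := by
    change (a : Z → ℂ) (g • z) + (b : Z → ℂ) (g • z) = (a : Z → ℂ) z + (b : Z → ℂ) z
    rw [ha g z, hb g z]
  algebraMap_mem' _ _ _ := rfl

/-!
The Nagata hypothesis, iterated on the dimension, says that an invariant linear functional which is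
not zero takes a nonzero value at some invariant vector. Applied to the preimage of a fixed line,
this shows that invariants lift along surjections of rational `G`-modules.

Lifting along the map from the free `A`-module on `I` onto `I A`, for `I` an ideal of the ring of
invariants `B` of a rational `G`-algebra `A`, gives `I A ∩ B = I`; hence `B` is Noetherian if `A`
is. If moreover `A` is graded by invariant subspaces with only scalars in degree zero, then `B` is
generated as an algebra by homogeneous generators of its ideal `B₊`.

In general, the generators of a finitely generated `A` lie in a finite-dimensional invariant
subspace `W`. The invariants of `A` lift along the surjection `Sym W → A`, so they are generated by
the images of generators of the invariants of the polynomial ring `Sym W`.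
-/

section RegularMaps

variable {K X Y M N : Type*} [CommSemiring K] [AddCommMonoid M] [Module K M] [AddCommMonoid N]
  [Module K N] {R : Subalgebra K (X → K)} {S : Subalgebra K (Y → K)}

/-- The regular maps from `X` to a `K`-module `M`, where `R` is the algebra of regular functions
on `X`: the image of `R ⊗ M` in the space of all maps `X → M`. -/
def regularMaps (R : Subalgebra K (X → K)) (M : Type*) [AddCommMonoid M] [Module K M] :
    Submodule K (X → M) :=
  Submodule.span K {F | ∃ a ∈ R, ∃ m : M, (fun x => a x • m) = F}

lemma smul_mem_regularMaps {a : X → K} (ha : a ∈ R) (m : M) :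
    (fun x => a x • m) ∈ regularMaps R M :=
  Submodule.subset_span ⟨a, ha, m, rfl⟩

lemma const_mem_regularMaps (m : M) : (fun _ => m) ∈ regularMaps R M := by
  simpa only [Pi.one_apply, one_smul] using smul_mem_regularMaps (one_mem R) m

lemma linearMap_comp_mem_regularMaps (L : M →ₗ[K] N) {F : X → M} (hF : F ∈ regularMaps R M) :
    (fun x => L (F x)) ∈ regularMaps R N := by
  suffices regularMaps R M ≤ (regularMaps R N).comap (L.compLeft X) from this hF
  refine Submodule.span_le.2 ?_
  rintro _ ⟨a, ha, m, rfl⟩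
  change (fun x => L (a x • m)) ∈ regularMaps R N
  simpa only [map_smul] using smul_mem_regularMaps ha (L m)

lemma comp_mem_regularMaps {φ : Y → X} (hφ : ∀ a ∈ R, a ∘ φ ∈ S) {F : X → M}
    (hF : F ∈ regularMaps R M) : (fun y => F (φ y)) ∈ regularMaps S M := by
  suffices regularMaps R M ≤ (regularMaps S M).comap (LinearMap.funLeft K M φ) from this hF
  refine Submodule.span_le.2 ?_
  rintro _ ⟨a, ha, m, rfl⟩
  exact smul_mem_regularMaps (hφ a ha) m

lemma mem_of_mem_regularMaps {F : X → K} (hF : F ∈ regularMaps R K) : F ∈ R := by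
  suffices regularMaps R K ≤ Subalgebra.toSubmodule R from this hF
  refine Submodule.span_le.2 ?_
  rintro _ ⟨a, ha, c, rfl⟩
  exact R.mul_mem ha (R.algebraMap_mem c)

lemma exists_fg_of_mem_regularMaps {F : X → M} (hF : F ∈ regularMaps R M) :
    ∃ U : Submodule K M, U.FG ∧ ∀ x, F x ∈ U := by
  induction hF using Submodule.span_induction with
  | mem F hF =>
    obtain ⟨a, -, m, rfl⟩ := hF
    exact ⟨K ∙ m, Submodule.fg_span_singleton m,
      fun x => Submodule.smul_mem _ _ (Submodule.mem_span_singleton_self m)⟩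
  | zero => exact ⟨⊥, Submodule.fg_bot, fun _ => zero_mem _⟩
  | add F F' _ _ hF hF' =>
    obtain ⟨U, hU, hFU⟩ := hF
    obtain ⟨U', hU', hFU'⟩ := hF'
    exact ⟨U ⊔ U', hU.sup hU', fun x => Submodule.add_mem_sup (hFU x) (hFU' x)⟩
  | smul c F _ hF =>
    obtain ⟨U, hU, hFU⟩ := hF
    exact ⟨U, hU, fun x => U.smul_mem c (hFU x)⟩

lemma mul_mem_regularMaps {A : Type*} [Semiring A] [Algebra K A] {F F' : X → A}
    (hF : F ∈ regularMaps R A) (hF' : F' ∈ regularMaps R A) : F * F' ∈ regularMaps R A := by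
  suffices regularMaps R A * regularMaps R A ≤ regularMaps R A from
    this (Submodule.mul_mem_mul hF hF')
  rw [regularMaps, Submodule.span_mul_span, Submodule.span_le]
  rintro _ ⟨_, ⟨a, ha, m, rfl⟩, _, ⟨b, hb, n, rfl⟩, rfl⟩
  have hmul : (fun x => a x • m) * (fun x => b x • n) = fun x => (a * b) x • (m * n) :=
    funext fun x => smul_mul_smul_comm (a x) m (b x) n
  change (fun x => a x • m) * (fun x => b x • n) ∈ regularMaps R A
  rw [hmul]
  exact smul_mem_regularMaps (mul_mem ha hb) (m * n)

/-- The regular maps to an algebra `A` form a subalgebra of the algebra of all maps `X → A`. -/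
def regularSubalgebra (R : Subalgebra K (X → K)) (A : Type*) [Semiring A] [Algebra K A] :
    Subalgebra K (X → A) :=
  (regularMaps R A).toSubalgebra (const_mem_regularMaps 1) fun _ _ => mul_mem_regularMaps

end RegularMaps

lemma mem_regularMaps_of_subtype {K X M : Type*} [Field K] [AddCommGroup M] [Module K M]
    {R : Subalgebra K (X → K)} {U : Submodule K M} {F : X → U}
    (hF : (fun x => (F x : M)) ∈ regularMaps R M) : F ∈ regularMaps R U := by
  obtain ⟨p, hp⟩ := U.subtype.exists_leftInverse_of_injective U.ker_subtype
  convert linearMap_comp_mem_regularMaps p hF using 1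
  exact funext fun x => (LinearMap.congr_fun hp (F x)).symm

section Rational

variable {K G M : Type*} [Monoid G]

/-- A representation is rational with respect to the algebra `R` of regular functions on `G` if
all its orbit maps `g ↦ ρ g v` are regular. This makes it locally finite, so that the definition
is appropriate in infinite dimension as well. -/
def IsRational [CommSemiring K] [AddCommMonoid M] [Module K M] (R : Subalgebra K (G → K))
    (ρ : Representation K G M) : Prop :=
  ∀ v, (fun g => ρ g v) ∈ regularMaps R M

lemma finsupp_representation_apply [CommSemiring K] [AddCommMonoid M] [Module K M]
    (ρ : Representation K G M) {ι : Type*} (g : G) (v : ι →₀ M) (i : ι) :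
    ρ.finsupp ι g v i = ρ g (v i) := by
  have hmap : ρ.finsupp ι g = Finsupp.mapRange.linearMap (ρ g) := by
    ext : 2
    simp
  rw [hmap, Finsupp.mapRange.linearMap_apply, Finsupp.mapRange_apply]

lemma IsRational.finsupp [CommSemiring K] [AddCommMonoid M] [Module K M]
    {R : Subalgebra K (G → K)} {ρ : Representation K G M} (hρ : IsRational R ρ) (ι : Type*) :
    IsRational R (ρ.finsupp ι) := by
  intro v
  induction v using Finsupp.induction_linear with
  | zero => simpa only [map_zero] using const_mem_regularMaps 0
  | add v w hv hw =>
    simp only [map_add]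
    exact add_mem hv hw
  | single i m =>
    simpa only [Representation.finsupp_single, Finsupp.lsingle_apply] using
      linearMap_comp_mem_regularMaps (Finsupp.lsingle i) (hρ m)

variable [Field K] [AddCommGroup M] [Module K M] {R : Subalgebra K (G → K)}
  {ρ : Representation K G M}

lemma IsRational.toRepresentation (hρ : IsRational R ρ) (σ : Subrepresentation ρ) :
    IsRational R σ.toRepresentation :=
  fun v => mem_regularMaps_of_subtype (hρ v)

/-- The subrepresentation spanned by the orbit of a vector. -/
def orbitSpan (ρ : Representation K G M) (v : M) : Subrepresentation ρ where
  toSubmodule := Submodule.span K (Set.range fun g => ρ g v)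
  apply_mem_toSubmodule g := by
    let U := Submodule.span K (Set.range fun g => ρ g v)
    suffices U ≤ U.comap (ρ g) from this
    refine Submodule.span_le.2 ?_
    rintro _ ⟨h, rfl⟩
    exact Submodule.subset_span ⟨g * h, by simp only [map_mul, Module.End.mul_apply]⟩

lemma mem_orbitSpan (ρ : Representation K G M) (v : M) : v ∈ orbitSpan ρ v :=
  Submodule.subset_span ⟨1, by simp only [map_one, Module.End.one_apply]⟩

lemma IsRational.finiteDimensional_orbitSpan (hρ : IsRational R ρ) (v : M) :
    FiniteDimensional K (orbitSpan ρ v).toSubmodule := by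
  obtain ⟨U, hU, hvU⟩ := exists_fg_of_mem_regularMaps (hρ v)
  have : FiniteDimensional K U := Module.Finite.of_fg hU
  exact Submodule.finiteDimensional_of_le (Submodule.span_le.2 (Set.range_subset_iff.2 hvU))

lemma IsRational.exists_finiteDimensional_subrepresentation (hρ : IsRational R ρ) {s : Set M}
    (hs : s.Finite) :
    ∃ σ : Subrepresentation ρ, FiniteDimensional K σ.toSubmodule ∧ s ⊆ σ := by
  induction s, hs using Set.Finite.induction_on with
  | empty => exact ⟨⊥, finiteDimensional_bot K M, Set.empty_subset _⟩
  | @insert v s _ _ ih =>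
    obtain ⟨σ, _, hsσ⟩ := ih
    have := hρ.finiteDimensional_orbitSpan v
    refine ⟨orbitSpan ρ v ⊔ σ, ?_, Set.insert_subset ?_ fun w hw => ?_⟩
    · rw [Subrepresentation.toSubmodule_sup]
      infer_instance
    · exact (le_sup_left : orbitSpan ρ v ≤ orbitSpan ρ v ⊔ σ) (mem_orbitSpan ρ v)
    · exact (le_sup_right : σ ≤ orbitSpan ρ v ⊔ σ) (hsσ hw)

end Rational

section Nagata

open Module

universe v

variable {K : Type*} {G : Type*} {M : Type v} {N : Type*} [Field K] [Monoid G] [AddCommGroup M]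
  [Module K M] [AddCommGroup N] [Module K N] {R : Subalgebra K (G → K)}
  {ρ : Representation K G M} {τ : Representation K G N}

/-- The Nagata hypothesis for a monoid `G` with respect to an algebra `R` of regular functions
on it: an invariant hyperplane with trivial quotient in a finite-dimensional rational
representation can be replaced by an invariant hyperplane with a trivial invariant complement. -/
def NagataProperty (R : Subalgebra K (G → K)) : Prop :=
  ∀ (M : Type v) [AddCommGroup M] [Module K M] [FiniteDimensional K M]
    (ρ : Representation K G M), (∀ (v : M) (l : Dual K M), (fun g => l (ρ g v)) ∈ R) →
    ∀ N : Submodule K M, finrank K (M ⧸ N) = 1 → (∀ g, ∀ v ∈ N, ρ g v ∈ N) →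
      (∀ g v, ρ g v - v ∈ N) →
      ∃ H P : Submodule K M, IsCompl H P ∧ finrank K (M ⧸ H) = 1 ∧
        (∀ g, ∀ v ∈ H, ρ g v ∈ H) ∧ (∀ g, ∀ v ∈ P, ρ g v = v)

lemma NagataProperty.exists_invariant_of_finiteDimensional (hN : NagataProperty.{v} R)
    [FiniteDimensional K M] (hρ : IsRational R ρ) {l : Dual K M} (hl : l ≠ 0)
    (hlρ : ∀ g v, l (ρ g v) = l v) : ∃ v, (∀ g, ρ g v = v) ∧ l v ≠ 0 := by
  induction hd : finrank K M using Nat.strong_induction_on generalizing M with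
  | _ d ih =>
  have hker : finrank K (M ⧸ LinearMap.ker l) = 1 := by
    rw [(l.quotKerEquivOfSurjective (LinearMap.surjective hl)).finrank_eq, finrank_self]
  obtain ⟨H, P, hHP, hH1, hH, hP⟩ := hN M ρ
    (fun v f => mem_of_mem_regularMaps (linearMap_comp_mem_regularMaps f (hρ v)))
    (LinearMap.ker l) hker (fun g v hv => (hlρ g v).trans hv)
    (fun g v => by rw [LinearMap.mem_ker, map_sub, hlρ, sub_self])
  by_cases hlP : P ≤ LinearMap.ker l
  · let σ : Subrepresentation ρ := ⟨H, hH⟩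
    have hlt : finrank K H < d := by
      have := H.finrank_quotient_add_finrank
      omega
    have hlH : l ∘ₗ H.subtype ≠ 0 := fun h0 => hl <| LinearMap.ker_eq_top.1 <| top_le_iff.1 <| by
      rw [← hHP.sup_eq_top]
      exact sup_le (fun v hv => LinearMap.congr_fun h0 ⟨v, hv⟩) hlP
    obtain ⟨v, hv, hlv⟩ := ih _ hlt (hρ.toRepresentation σ) hlH (fun g v => hlρ g v) rfl
    exact ⟨v, fun g => congrArg Subtype.val (hv g), hlv⟩
  · obtain ⟨v, hvP, hvl⟩ := SetLike.not_le_iff_exists.1 hlP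
    exact ⟨v, fun g => hP g v hvP, hvl⟩

lemma NagataProperty.exists_invariant (hN : NagataProperty.{v} R) (hρ : IsRational R ρ)
    {l : Dual K M} (hl : l ≠ 0) (hlρ : ∀ g v, l (ρ g v) = l v) :
    ∃ v, (∀ g, ρ g v = v) ∧ l v ≠ 0 := by
  obtain ⟨w, hw⟩ : ∃ w, l w ≠ 0 := by
    contrapose! hl
    exact LinearMap.ext hl
  obtain ⟨σ, _, hwσ⟩ := hρ.exists_finiteDimensional_subrepresentation (Set.finite_singleton w)
  obtain ⟨v, hv, hlv⟩ := hN.exists_invariant_of_finiteDimensional (hρ.toRepresentation σ)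
    (l := l ∘ₗ σ.toSubmodule.subtype)
    (fun h0 => hw (LinearMap.congr_fun h0 ⟨w, hwσ rfl⟩)) (fun g v => hlρ g v)
  exact ⟨v, fun g => congrArg Subtype.val (hv g), hlv⟩

theorem NagataProperty.exists_invariant_lift (hN : NagataProperty.{v} R) (hρ : IsRational R ρ)
    {φ : M →ₗ[K] N} (hφ : ρ.IsIntertwiningMap τ φ) {v : M} (hv : ∀ g, τ g (φ v) = φ v) :
    ∃ v', (∀ g, ρ g v' = v') ∧ φ v' = φ v := by
  by_cases h0 : φ v = 0
  · exact ⟨0, fun g => map_zero (ρ g), by rw [map_zero, h0]⟩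
  have hfix : ∀ x ∈ (K ∙ φ v).comap φ, ∀ g, φ (ρ g x) = φ x := by
    intro x hx g
    obtain ⟨c, hc⟩ := Submodule.mem_span_singleton.1 (Submodule.mem_comap.1 hx)
    rw [hφ.isIntertwining, ← hc, map_smul, hv g]
  -- On the preimage of the fixed line `K ∙ φ v`, the map `φ` amounts to an invariant functional.
  let σ : Subrepresentation ρ :=
    ⟨(K ∙ φ v).comap φ, fun g x hx => by rwa [Submodule.mem_comap, hfix x hx g]⟩
  obtain ⟨l, hl⟩ := Projective.exists_dual_eq_one K h0
  obtain ⟨⟨x, hx⟩, hxinv, hlx⟩ := hN.exists_invariant (hρ.toRepresentation σ)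
    (l := l ∘ₗ φ ∘ₗ σ.toSubmodule.subtype)
    (fun h => one_ne_zero <| hl.symm.trans <|
      LinearMap.congr_fun h ⟨v, Submodule.mem_span_singleton_self (φ v)⟩)
    (fun g x => congrArg l (hfix x x.2 g))
  obtain ⟨c, hc⟩ := Submodule.mem_span_singleton.1 (Submodule.mem_comap.1 hx)
  have hc0 : c ≠ 0 := by
    rintro rfl
    exact hlx (by simp [← hc])
  have hρx : ∀ g, ρ g x = x := fun g => congrArg Subtype.val (hxinv g)
  exact ⟨c⁻¹ • x, fun g => by rw [map_smul, hρx], by rw [map_smul, ← hc, inv_smul_smul₀ hc0]⟩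

end Nagata

section AlgebraActions

variable {K G A : Type*} [CommSemiring K] [Monoid G] [Semiring A] [Algebra K A]

/-- The linear representation underlying an action by algebra endomorphisms. -/
abbrev algRep (α : G →* (A →ₐ[K] A)) : Representation K G A :=
  AlgHom.toEnd.comp α

/-- The subalgebra of invariants of an action by algebra endomorphisms. -/
def fixedSubalgebra (α : G →* (A →ₐ[K] A)) : Subalgebra K A where
  carrier := {x | ∀ g, α g x = x}
  mul_mem' hx hy g := by rw [map_mul, hx g, hy g]
  add_mem' hx hy g := by rw [map_add, hx g, hy g]
  algebraMap_mem' r g := (α g).commutes r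

lemma isRational_of_adjoin_eq_top {R : Subalgebra K (G → K)} {α : G →* (A →ₐ[K] A)} {s : Set A}
    (hs : Algebra.adjoin K s = ⊤) (hα : ∀ x ∈ s, (fun g => α g x) ∈ regularMaps R A) :
    IsRational R (algRep α) := by
  have hle : Algebra.adjoin K s ≤ (regularSubalgebra R A).comap (AlgHom.pi fun g => α g) :=
    Algebra.adjoin_le hα
  exact fun x => hle (hs ▸ Algebra.mem_top)

lemma isHomogeneous_fixedSubalgebra {ι : Type*} [DecidableEq ι] [AddMonoid ι]
    (𝒜 : ι → Submodule K A) [GradedAlgebra 𝒜] {α : G →* (A →ₐ[K] A)}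
    (hα : ∀ g i, ∀ x ∈ 𝒜 i, α g x ∈ 𝒜 i) :
    DirectSum.SetLike.IsHomogeneous 𝒜 (fixedSubalgebra α) := by
  intro i x hx g
  let αg : 𝒜 →ₐᵍ[K] 𝒜 := { α g with map_mem := fun {i x} => hα g i x }
  exact (map_directSumDecompose 𝒜 𝒜 αg).trans (by rw [show αg x = x from hx g])

end AlgebraActions

section Noetherian

universe v

variable {K G : Type*} {A : Type v} [Field K] [Monoid G] [CommRing A] [Algebra K A]
  {R : Subalgebra K (G → K)} {α : G →* (A →ₐ[K] A)}

theorem NagataProperty.comap_map_fixedSubalgebra (hN : NagataProperty.{v} R)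
    (hα : IsRational R (algRep α)) (I : Ideal (fixedSubalgebra α)) :
    (I.map (algebraMap (fixedSubalgebra α) A)).comap (algebraMap (fixedSubalgebra α) A) = I := by
  refine le_antisymm (fun x hx => ?_) Ideal.le_comap_map
  let b : I → A := fun y => (y : fixedSubalgebra α)
  let φ : (I →₀ A) →ₗ[K] A := (Finsupp.linearCombination A b).restrictScalars K
  have hφ : ((algRep α).finsupp I).IsIntertwiningMap (algRep α) φ := by
    refine ⟨fun g c => ?_⟩
    suffices h : φ ∘ₗ (algRep α).finsupp I g = (α g).toLinearMap ∘ₗ φ from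
      LinearMap.congr_fun h c
    ext y a
    have hy : α g (b y) = b y := y.1.2 g
    simp [φ, hy]
  obtain ⟨c, hc⟩ : ∃ c, φ c = x := by
    rw [Ideal.mem_comap, Ideal.map, Set.image_eq_range] at hx
    exact (Finsupp.mem_span_range_iff_exists_finsupp).1 hx
  obtain ⟨c', hc', hcx⟩ := hN.exists_invariant_lift (hα.finsupp I) hφ (v := c)
    (fun g => by rw [hc]; exact x.2 g)
  have hc'fix : ∀ y, c' y ∈ fixedSubalgebra α := fun y g =>
    (finsupp_representation_apply _ g c' y).symm.trans (DFunLike.congr_fun (hc' g) y)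
  have hx' : x = ∑ y ∈ c'.support, ⟨c' y, hc'fix y⟩ * (y : fixedSubalgebra α) :=
    Subtype.ext <| by
      rw [← hc, ← hcx, AddSubmonoidClass.coe_finsetSum]
      rfl
  rw [hx']
  exact sum_mem fun y _ => I.mul_mem_left _ y.2

theorem NagataProperty.isNoetherianRing_fixedSubalgebra [IsNoetherianRing A]
    (hN : NagataProperty.{v} R) (hα : IsRational R (algRep α)) :
    IsNoetherianRing (fixedSubalgebra α) := by
  have hinj : Function.Injective (Ideal.map (algebraMap (fixedSubalgebra α) A)) :=
    Function.LeftInverse.injective (hN.comap_map_fixedSubalgebra hα)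
  have hmono : StrictMono (Ideal.map (algebraMap (fixedSubalgebra α) A)) :=
    Monotone.strictMono_of_injective (fun _ _ => Ideal.map_mono) hinj
  exact isNoetherian_iff'.2 hmono.wellFoundedGT

end Noetherian

section Graded

variable {K S : Type*} [CommSemiring K] [CommSemiring S] [Algebra K S] (𝒜 : ℕ → Submodule K S)
  [GradedAlgebra 𝒜]

lemma mem_adjoin_of_isHomogeneous {B : Subalgebra K S} (h0 : 𝒜 0 ≤ 1)
    (hB : DirectSum.SetLike.IsHomogeneous 𝒜 B) {T : Finset B}
    (hT : ∀ t ∈ T, ∃ e, 0 < e ∧ (t : S) ∈ 𝒜 e)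
    (hspan : ∀ d, 0 < d → ∀ b : B, (b : S) ∈ 𝒜 d → b ∈ Ideal.span (T : Set B)) (d : ℕ) (b : B)
    (hb : (b : S) ∈ 𝒜 d) : b ∈ Algebra.adjoin K (T : Set B) := by
  induction d using Nat.strong_induction_on generalizing b with
  | _ d ih =>
  rcases d.eq_zero_or_pos with rfl | hd
  · obtain ⟨k, hk⟩ := Submodule.mem_one.1 (h0 hb)
    exact (Subtype.ext hk : algebraMap K B k = b) ▸ Subalgebra.algebraMap_mem _ k
  obtain ⟨c, hc⟩ := Submodule.mem_span_finset'.1 (hspan d hd b hb)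
  choose e he0 he using fun t : T => hT t t.2
  have hdecomp : (b : S) = ∑ t : T, DirectSum.decompose 𝒜 ((c t : S) * (t : B)) d := by
    rw [← DirectSum.decompose_of_mem_same 𝒜 hb, ← hc]
    simp [DirectSum.decompose_sum]
  -- Taking components of degree `d` replaces the coefficient of `t` by one of degree `d - e t`.
  let c' : T → B := fun t => ⟨DirectSum.decompose 𝒜 (c t : S) (d - e t), hB _ (c t).2⟩
  have hb' : b = ∑ t : T, if e t ≤ d then c' t * t else 0 := by
    refine Subtype.ext (hdecomp.trans ?_)
    rw [AddSubmonoidClass.coe_finsetSum, AddSubmonoidClass.coe_finsetSum]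
    refine Finset.sum_congr rfl fun t _ => ?_
    rw [DirectSum.coe_decompose_mul_of_right_mem 𝒜 d (he t), apply_ite Subtype.val]
    rfl
  rw [hb']
  refine Subalgebra.sum_mem _ fun t _ => ?_
  split_ifs
  · exact mul_mem (ih _ (Nat.sub_lt hd (he0 t)) _ (SetLike.coe_mem _))
      (Algebra.subset_adjoin t.2)
  · exact zero_mem _

theorem finiteType_of_isHomogeneous {B : Subalgebra K S} [IsNoetherianRing B] (h0 : 𝒜 0 ≤ 1)
    (hB : DirectSum.SetLike.IsHomogeneous 𝒜 B) : Algebra.FiniteType K B := by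
  let s : Set B := {b | ∃ d, 0 < d ∧ (b : S) ∈ 𝒜 d}
  obtain ⟨T, hTs, hT⟩ := (Submodule.fg_span_iff_fg_span_finset_subset s).1
    (IsNoetherian.noetherian (Ideal.span s))
  have hspan : ∀ d, 0 < d → ∀ b : B, (b : S) ∈ 𝒜 d → b ∈ Ideal.span (T : Set B) :=
    fun d hd b hb => hT.le (Submodule.subset_span ⟨d, hd, hb⟩)
  refine ⟨⟨T, eq_top_iff.2 fun b _ => ?_⟩⟩
  classical
  let component : ℕ → B := fun d => ⟨DirectSum.decompose 𝒜 (b : S) d, hB d b.2⟩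
  have hb : b = ∑ d ∈ (DirectSum.decompose 𝒜 (b : S)).support, component d :=
    Subtype.ext <| (DirectSum.sum_support_decompose 𝒜 (b : S)).symm.trans
      (AddSubmonoidClass.coe_finsetSum component _).symm
  rw [hb]
  exact sum_mem fun d _ =>
    mem_adjoin_of_isHomogeneous 𝒜 h0 hB hTs hspan d _ (SetLike.coe_mem _)

end Graded

section SymmetricAlgebra

variable {K G W S : Type*} [CommSemiring K] [Monoid G] [AddCommMonoid W] [Module K W]
  [CommSemiring S] [Algebra K S] {f : W →ₗ[K] S}

/-- The action on a symmetric algebra `f : W → S` of `W` induced by a representation on `W`. -/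
noncomputable def symAction (h : IsSymmetricAlgebra f) (σ : Representation K G W) :
    G →* (S →ₐ[K] S) where
  toFun g := h.lift (f ∘ₗ σ g)
  map_one' := h.algHom_ext <| LinearMap.ext fun w => by simp
  map_mul' g g' := h.algHom_ext <| LinearMap.ext fun w => by simp [h.lift_eq]

lemma symAction_apply (h : IsSymmetricAlgebra f) (σ : Representation K G W) (g : G) (w : W) :
    symAction h σ g (f w) = f (σ g w) :=
  h.lift_eq (f ∘ₗ σ g) w

lemma adjoin_range_of_isSymmetricAlgebra (h : IsSymmetricAlgebra f) :
    Algebra.adjoin K (Set.range f) = ⊤ := by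
  refine eq_top_iff.2 fun x _ => ?_
  induction x using h.induction with
  | algebraMap r => exact Subalgebra.algebraMap_mem _ r
  | ι w => exact Algebra.subset_adjoin ⟨w, rfl⟩
  | mul x y hx hy => exact mul_mem (hx trivial) (hy trivial)
  | add x y hx hy => exact add_mem (hx trivial) (hy trivial)

lemma isRational_symAction {R : Subalgebra K (G → K)} (h : IsSymmetricAlgebra f)
    {σ : Representation K G W} (hσ : IsRational R σ) :
    IsRational R (algRep (symAction h σ)) := by
  refine isRational_of_adjoin_eq_top (adjoin_range_of_isSymmetricAlgebra h) ?_
  rintro _ ⟨w, rfl⟩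
  simpa only [symAction_apply] using linearMap_comp_mem_regularMaps f (hσ w)

lemma isIntertwiningMap_lift_symAction (h : IsSymmetricAlgebra f) {A : Type*} [CommSemiring A]
    [Algebra K A] {α : G →* (A →ₐ[K] A)} {σ : Representation K G W} {L : W →ₗ[K] A}
    (hL : σ.IsIntertwiningMap (algRep α) L) :
    (algRep (symAction h σ)).IsIntertwiningMap (algRep α) (h.lift L).toLinearMap := by
  refine ⟨fun g x => ?_⟩
  suffices hcomp : (h.lift L).comp (symAction h σ g) = (α g).comp (h.lift L) from
    DFunLike.congr_fun hcomp x
  refine h.algHom_ext <| LinearMap.ext fun w => ?_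
  simpa [symAction_apply, h.lift_eq] using hL.isIntertwining g w

end SymmetricAlgebra

section Finiteness

open MvPolynomial SymmetricAlgebra

universe u

theorem NagataProperty.finiteType_fixedSubalgebra_of_graded {K G : Type*} {S : Type u} [Field K]
    [Monoid G] [CommRing S] [IsNoetherianRing S] [Algebra K S] {R : Subalgebra K (G → K)}
    (hN : NagataProperty.{u} R) (𝒜 : ℕ → Submodule K S) [GradedAlgebra 𝒜] (h0 : 𝒜 0 ≤ 1)
    {α : G →* (S →ₐ[K] S)} (hα : IsRational R (algRep α))
    (hα𝒜 : ∀ g d, ∀ x ∈ 𝒜 d, α g x ∈ 𝒜 d) : Algebra.FiniteType K (fixedSubalgebra α) :=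
  have := hN.isNoetherianRing_fixedSubalgebra hα
  finiteType_of_isHomogeneous 𝒜 h0 (isHomogeneous_fixedSubalgebra 𝒜 hα𝒜)

lemma isHomogeneous_constr_X {K ι W : Type*} [CommSemiring K] [AddCommMonoid W] [Module K W]
    (b : Module.Basis ι K W) (w : W) :
    (b.constr K (X : ι → MvPolynomial ι K) w).IsHomogeneous 1 := by
  rw [b.constr_apply K, Finsupp.sum]
  exact IsHomogeneous.sum _ _ _ fun i _ => (homogeneousSubmodule ι K 1).smul_mem _
    (isHomogeneous_X K i)

lemma isHomogeneous_symAction {K G ι W : Type*} [CommSemiring K] [Monoid G] [AddCommMonoid W]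
    [Module K W] (b : Module.Basis ι K W) (σ : Representation K G W) (g : G) {d : ℕ}
    {p : MvPolynomial ι K} (hp : p.IsHomogeneous d) :
    (symAction (IsSymmetricAlgebra.mvPolynomial ι b) σ g p).IsHomogeneous d := by
  let h := IsSymmetricAlgebra.mvPolynomial ι b
  have hX : ∀ i, (symAction h σ g (X i)).IsHomogeneous 1 := fun i => by
    rw [← b.constr_basis K X i, symAction_apply]
    exact isHomogeneous_constr_X b (σ g (b i))
  rw [aeval_unique (symAction h σ g)]
  exact one_mul d ▸ hp.aeval _ hX

variable {K : Type u} {G : Type*} [Field K] [Monoid G] {R : Subalgebra K (G → K)}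

theorem NagataProperty.finiteType_fixedSubalgebra_symAction (hN : NagataProperty.{u} R) {n : ℕ}
    {W : Type*} [AddCommGroup W] [Module K W] (b : Module.Basis (Fin n) K W)
    {σ : Representation K G W} (hσ : IsRational R σ) :
    Algebra.FiniteType K
      (fixedSubalgebra (symAction (IsSymmetricAlgebra.mvPolynomial (Fin n) b) σ)) :=
  have := MvPolynomial.gradedAlgebra (σ := Fin n) (R := K)
  hN.finiteType_fixedSubalgebra_of_graded (homogeneousSubmodule (Fin n) K)
    (homogeneousSubmodule_zero (Fin n)).le (isRational_symAction _ hσ)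
    fun g _ _ hp => isHomogeneous_symAction b σ g hp

lemma NagataProperty.map_fixedSubalgebra {A : Type*} [CommRing A] [Algebra K A]
    {S : Type u} [CommRing S] [Algebra K S]
    (hN : NagataProperty.{u} R) {α : G →* (A →ₐ[K] A)} {β : G →* (S →ₐ[K] S)}
    (hβ : IsRational R (algRep β)) {φ : S →ₐ[K] A} (hφ : Function.Surjective φ)
    (hφβα : (algRep β).IsIntertwiningMap (algRep α) φ.toLinearMap) :
    (fixedSubalgebra β).map φ = fixedSubalgebra α := by
  apply le_antisymm
  · rintro _ ⟨p, hp, rfl⟩ g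
    exact (hφβα.isIntertwining g p).symm.trans (congrArg φ (hp g))
  · intro x hx
    obtain ⟨p, rfl⟩ := hφ x
    obtain ⟨q, hq, hqp⟩ := hN.exists_invariant_lift hβ hφβα (v := p) hx
    exact ⟨q, hq, hqp⟩

theorem mainTheorem8_general (hN : NagataProperty.{u} R) {A : Type*} [CommRing A] [Algebra K A]
    [Algebra.FiniteType K A] {α : G →* (A →ₐ[K] A)} (hα : IsRational R (algRep α)) :
    Algebra.FiniteType K (fixedSubalgebra α) := by
  obtain ⟨s, hs⟩ := (Algebra.FiniteType.out : (⊤ : Subalgebra K A).FG)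
  obtain ⟨σ, _, hsσ⟩ := hα.exists_finiteDimensional_subrepresentation s.finite_toSet
  let b := Module.finBasis K σ.toSubmodule
  let h := IsSymmetricAlgebra.mvPolynomial _ b
  let φ := h.lift σ.toSubmodule.subtype
  have hφ : Function.Surjective φ := by
    rw [← AlgHom.range_eq_top, eq_top_iff, ← hs]
    exact Algebra.adjoin_le fun x hx => ⟨_, h.lift_eq _ ⟨x, hsσ hx⟩⟩
  have hσ := hα.toRepresentation σ
  rw [← hN.map_fixedSubalgebra (isRational_symAction h hσ) hφ
    (isIntertwiningMap_lift_symAction h ⟨fun _ _ => rfl⟩), ← Subalgebra.fg_iff_finiteType]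
  exact ((Subalgebra.fg_iff_finiteType _).2 (hN.finiteType_fixedSubalgebra_symAction b hσ)).map φ

end Finiteness

section AffineVarieties

open MvPolynomial

lemma eval_bind₁ {σ τ K : Type*} [CommSemiring K] (x : τ → K) (P : σ → MvPolynomial τ K)
    (p : MvPolynomial σ K) : eval x (bind₁ P p) = eval (fun i => eval x (P i)) p :=
  eval₂Hom_bind₁ _ _ _ _

variable {n m k : ℕ} {X : Set (Fin n → ℂ)} {Y : Set (Fin m → ℂ)} {W : Set (Fin k → ℂ)}

lemma restrictPoly_apply (p : MvPolynomial (Fin n) ℂ) (x : X) :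
    restrictPoly X p x = eval (x : Fin n → ℂ) p := by
  simp [restrictPoly, aeval_eq_eval]

lemma finiteType_coordRing (X : Set (Fin n → ℂ)) : Algebra.FiniteType ℂ (coordRing X) :=
  Algebra.FiniteType.of_surjective (restrictPoly X).rangeRestrict
    (restrictPoly X).rangeRestrict_surjective

lemma eval_mem_coordRing (p : MvPolynomial (Fin n) ℂ) :
    (fun x : X => eval (x : Fin n → ℂ) p) ∈ coordRing X :=
  ⟨p, funext (restrictPoly_apply p)⟩

lemma IsPolyMap.comp_mem_coordRing {φ : X → Y} (hφ : IsPolyMap φ) {f : Y → ℂ}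
    (hf : f ∈ coordRing Y) : f ∘ φ ∈ coordRing X := by
  obtain ⟨P, hP⟩ := hφ
  obtain ⟨p, rfl⟩ := hf
  convert eval_mem_coordRing (bind₁ P p) using 1
  ext x
  rw [eval_bind₁, ← funext (hP x)]
  exact restrictPoly_apply p (φ x)

lemma IsPolyMap₂.isPolyMap_right {φ : X → Y → W} (hφ : IsPolyMap₂ φ) (x : X) :
    IsPolyMap (φ x) := by
  obtain ⟨P, hP⟩ := hφ
  refine ⟨fun i => bind₁ (Sum.elim (fun j => C ((x : Fin n → ℂ) j)) MvPolynomial.X) (P i),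
    fun y i => ?_⟩
  rw [hP, eval_bind₁]
  congr 2
  ext (j | j) <;> simp

/-- The homomorphism of coordinate rings `f ↦ f ∘ φ` induced by a morphism `φ`. -/
def IsPolyMap.pullback {φ : X → Y} (hφ : IsPolyMap φ) : coordRing Y →ₐ[ℂ] coordRing X where
  toFun f := ⟨f ∘ φ, hφ.comp_mem_coordRing f.2⟩
  map_one' := rfl
  map_mul' _ _ := rfl
  map_zero' := rfl
  map_add' _ _ := rfl
  commutes' _ := rfl

lemma eval_sumElim_mem_regularMaps (p : MvPolynomial (Fin n ⊕ Fin m) ℂ) :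
    (fun (x : X) (y : Y) => eval (Sum.elim (x : Fin n → ℂ) (y : Fin m → ℂ)) p) ∈
      regularMaps (coordRing X) (Y → ℂ) := by
  induction p using MvPolynomial.induction_on with
  | C c => simpa only [eval_C] using const_mem_regularMaps (fun _ => c)
  | add p q hp hq =>
    simp only [map_add]
    exact add_mem hp hq
  | mul_X p i hp =>
    simp only [map_mul, eval_X]
    refine mul_mem_regularMaps hp ?_
    rcases i with i | i
    · simpa [Pi.smul_def] using
        smul_mem_regularMaps (eval_mem_coordRing (MvPolynomial.X i)) (1 : Y → ℂ)
    · exact const_mem_regularMaps fun y : Y => (y : Fin m → ℂ) i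

lemma IsPolyMap₂.comp_mem_regularMaps {φ : X → Y → W} (hφ : IsPolyMap₂ φ) {f : W → ℂ}
    (hf : f ∈ coordRing W) : (fun x y => f (φ x y)) ∈ regularMaps (coordRing X) (Y → ℂ) := by
  obtain ⟨P, hP⟩ := hφ
  obtain ⟨p, rfl⟩ := hf
  convert eval_sumElim_mem_regularMaps (bind₁ P p) using 1
  ext x y
  rw [eval_bind₁, ← funext (hP x y)]
  exact restrictPoly_apply p (φ x y)

variable {G : Set (Fin n → ℂ)} [Group G] {Z : Set (Fin m → ℂ)} [MulAction G Z]

/-- The action of `G` on the coordinate ring of a `G`-variety, given by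
`(g • f) z = f (g⁻¹ • z)`. -/
def coordRingAction (h : IsPolyMap₂ fun (g : G) (z : Z) => g • z) :
    G →* (coordRing Z →ₐ[ℂ] coordRing Z) where
  toFun g := (h.isPolyMap_right g⁻¹).pullback
  map_one' := AlgHom.ext fun f => Subtype.ext <| funext fun z =>
    congrArg (f : Z → ℂ) (by simp only [inv_one, one_smul])
  map_mul' g g' := AlgHom.ext fun f => Subtype.ext <| funext fun z =>
    congrArg (f : Z → ℂ) (by simp only [mul_inv_rev, mul_smul])

lemma isRational_coordRingAction (hinv : IsPolyMap fun g : G => g⁻¹)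
    (h : IsPolyMap₂ fun (g : G) (z : Z) => g • z) :
    IsRational (coordRing G) (algRep (coordRingAction h)) := fun f =>
  mem_regularMaps_of_subtype (U := Subalgebra.toSubmodule (coordRing Z)) <|
    comp_mem_regularMaps (fun _ => hinv.comp_mem_coordRing) (h.comp_mem_regularMaps f.2)

lemma fixedSubalgebra_coordRingAction (h : IsPolyMap₂ fun (g : G) (z : Z) => g • z) :
    fixedSubalgebra (coordRingAction h) = invariantRing G Z := by
  ext f
  refine ⟨fun hf g z => ?_, fun hf g => Subtype.ext (funext (hf g⁻¹))⟩
  have hfg := congrFun (congrArg Subtype.val (hf g⁻¹)) z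
  rwa [← inv_inv g]

end AffineVarieties

theorem mainTheorem8 {n m : ℕ} (G : Set (Fin n → ℂ)) [Group G] (hG : IsAlgebraicGroup G)
    (hN : NagataHypothesis G) (Z : Set (Fin m → ℂ)) [MulAction G Z]
    (hZ : IsAffineGVariety G Z) :
    Algebra.FiniteType ℂ (invariantRing G Z) := by
  have := finiteType_coordRing Z
  rw [← fixedSubalgebra_coordRingAction hZ.smul_isPolyMap]
  exact mainTheorem8_general hN (isRational_coordRingAction hG.inv_isPolyMap hZ.smul_isPolyMap)
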